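/- For a topological space $Y$, the suspension $\Sigma Y$ is the quotient of $Y\times[0,1]$ in which $Y\times\{0\}$ and $Y\times\{1\}$ are each collapsed to a point; these two points are the suspension points (and $\Sigma\varnothing$ is the discrete two-point space, both of whose points are suspension points). Let $X$ be a compact metrizable space that is homeomorphic to a suspension and is homogeneous, i.e. for all $p,q\in X$ there is a homeomorphism $h:X\to X$ with $h(p)=q$. Then: (1) $X$ is an absolute suspension: for any two distinct points $p,q\in X$ there are a space $Y$ and a homeomorphism $X\to\Sigma Y$ that maps $p$ and $q$ to the two suspension points of $\Sigma Y$; (2) $X$ is strongly $2$-homogeneous: every bijection between two $2$-element subsets of $X$ extends to a homeomorphism of $X$ onto itself. -/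

import Mathlib

universe u

/-- A space is homogeneous if any point can be moved to any other point by a self-homeomorphism. -/
def IsHomogeneousSpace (X : Type u) [TopologicalSpace X] : Prop :=
  ∀ p q : X, ∃ h : X ≃ₜ X, h p = q

/-- A space is strongly `n`-homogeneous if every bijection between two `n`-element subsets
extends to a self-homeomorphism. -/
def IsStronglyHomogeneous (n : ℕ) (X : Type u) [TopologicalSpace X] : Prop :=
  ∀ A B : Finset X, A.card = n → B.card = n →
    ∀ f : A ≃ B, ∃ h : X ≃ₜ X, ∀ a : A, h a = f a

/-- The cylinder `Y × [0, 1]` together with two extra points, `Sum.inr false` for the bottom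
and `Sum.inr true` for the top. -/
abbrev PreSuspension (Y : Type u) : Type u :=
  (Y × unitInterval) ⊕ Bool

/-- The height in `[0, 1]`; the extra bottom point has height `0`, the extra top point height `1`. -/
def PreSuspension.height {Y : Type u} : PreSuspension Y → unitInterval
  | Sum.inl (_, t) => t
  | Sum.inr false => 0
  | Sum.inr true => 1

/-- All points of height `0` are identified with each other, and so are all points of
height `1`; nothing else is identified. -/
def suspensionSetoid (Y : Type u) : Setoid (PreSuspension Y) where
  r a b := a = b ∨ (a.height = 0 ∧ b.height = 0) ∨ (a.height = 1 ∧ b.height = 1)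
  iseqv :=
    { refl := fun _ => Or.inl rfl
      symm := by
        rintro a b (h | h | h)
        · exact Or.inl h.symm
        · exact Or.inr (Or.inl h.symm)
        · exact Or.inr (Or.inr h.symm)
      trans := by
        rintro a b c (rfl | ⟨h1, h2⟩ | ⟨h1, h2⟩) (rfl | ⟨h3, h4⟩ | ⟨h3, h4⟩)
        · exact Or.inl rfl
        · exact Or.inr (Or.inl ⟨h3, h4⟩)
        · exact Or.inr (Or.inr ⟨h3, h4⟩)
        · exact Or.inr (Or.inl ⟨h1, h2⟩)
        · exact Or.inr (Or.inl ⟨h1, h4⟩)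
        · exact absurd (h2.symm.trans h3) zero_ne_one
        · exact Or.inr (Or.inr ⟨h1, h2⟩)
        · exact absurd (h3.symm.trans h2) zero_ne_one
        · exact Or.inr (Or.inr ⟨h1, h4⟩) }

/-- The (unreduced) suspension of `Y`, with the quotient topology. For nonempty `Y` the extra
points are absorbed, and this is `Y × [0, 1]` with `Y × {0}` and `Y × {1}` each collapsed to a
point; for empty `Y` it is the discrete two-point space. -/
def Suspension (Y : Type u) : Type u :=
  Quotient (suspensionSetoid Y)

instance Suspension.instTopologicalSpace (Y : Type u) [TopologicalSpace Y] :
    TopologicalSpace (Suspension Y) :=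
  inferInstanceAs (TopologicalSpace (Quotient (suspensionSetoid Y)))

/-- The two suspension points of the suspension: bottom (`false`) and top (`true`). -/
def Suspension.pole (Y : Type u) (b : Bool) : Suspension Y :=
  Quotient.mk (suspensionSetoid Y) (Sum.inr b)

/-- `X` is (homeomorphic to) a suspension. -/
def IsSuspension (X : Type u) [TopologicalSpace X] : Prop :=
  ∃ (Y : Type u) (_ : TopologicalSpace Y), Nonempty (X ≃ₜ Suspension Y)

/-- Any two distinct points of `X` are the suspension points for some homeomorphism of `X` with a
suspension. -/
def IsAbsoluteSuspension (X : Type u) [TopologicalSpace X] : Prop :=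
  ∀ p q : X, p ≠ q →
    ∃ (Y : Type u) (_ : TopologicalSpace Y) (e : X ≃ₜ Suspension Y),
      e p = Suspension.pole Y false ∧ e q = Suspension.pole Y true

/-! Write S and N for the bottom and top poles of ΣY. Both claims follow once any two distinct
points p, q are the images of S, N under one self-homeomorphism; by homogeneity q = N may be
assumed. Sliding along suspension lines fixes N and brings p into any given neighbourhood of S.
Effros's theorem (`exists_homeomorph_near_refl`) then gives a homeomorphism h close to the identity
taking S to the slid point, but h may move N. This is repaired in the manner of Brown's monotone
union theorem. Starting from h, `exists_agree_and_cover` produces homeomorphisms that agree on ever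
larger sublevel sets of the height, whose images miss N yet exhaust its complement. Their limit maps
ΣY ∖ {N} onto itself and extends by N ↦ N (`exists_homeomorph_of_exhaustion`). -/

open Filter Topology Set

/-! ### Effros's theorem for compact homogeneous metric spaces -/

section Effros

variable {X : Type*} [MetricSpace X]

/-- The points to which `x` is moved by self-homeomorphisms that move every point by less
than `ε`. -/
def nearOrbit (ε : ℝ) (x : X) : Set X :=
  {z | ∃ w : X ≃ₜ X, (∀ p, dist (w p) p < ε) ∧ w x = z}

theorem dist_le_of_mem_closure_nearOrbit {ε : ℝ} {x y : X} (h : y ∈ closure (nearOrbit ε x)) :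
    dist x y ≤ ε := by
  have : closure (nearOrbit ε x) ⊆ Metric.closedBall x ε := by
    refine closure_minimal ?_ Metric.isClosed_closedBall
    rintro _ ⟨w, hw, rfl⟩
    exact (hw x).le
  simpa [dist_comm] using this h

variable [CompactSpace X]

theorem exists_countable_uniformly_dense_homeomorph {ε : ℝ} (hε : 0 < ε) :
    ∃ s : Set (X ≃ₜ X), s.Countable ∧ ∀ g : X ≃ₜ X, ∃ k ∈ s, ∀ x, dist (g x) (k x) < ε := by
  let F : (X ≃ₜ X) → C(X, X) := fun g => ⟨g, g.continuous⟩
  have hsep : TopologicalSpace.IsSeparable (range F) :=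
    TopologicalSpace.IsSeparable.of_separableSpace _
  obtain ⟨t, ht, htc, htd⟩ := hsep.exists_countable_dense_subset
  choose! G hG using fun f (hf : f ∈ t) => ht hf
  refine ⟨G '' t, htc.image G, fun g => ?_⟩
  obtain ⟨f, hft, hf⟩ := Metric.mem_closure_iff.1 (htd ⟨g, rfl⟩) ε hε
  refine ⟨G f, ⟨f, hft, rfl⟩, fun x => ?_⟩
  have h1 : dist ((F g) x) (f x) ≤ dist (F g) f := ContinuousMap.dist_apply_le_dist x
  rw [← hG f hft] at h1 hf
  exact h1.trans_lt (by simpa [hG f hft] using hf)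

/-- Baire category: countably many homeomorphisms approximate all others, so countably many
preimages of the closed near-orbit cover `X` and one has interior. A small homeomorphism then
carries that interior back to `x`, at the cost of doubling the radius. -/
theorem closure_nearOrbit_mem_nhds
    (hhom : ∀ p q : X, ∃ h : X ≃ₜ X, h p = q) {ε : ℝ} (hε : 0 < ε) (x : X) :
    closure (nearOrbit ε x) ∈ 𝓝 x := by
  obtain ⟨s, hsc, hs⟩ := exists_countable_uniformly_dense_homeomorph (X := X) (half_pos hε)
  have hcover : (⋃ k ∈ s, k ⁻¹' closure (nearOrbit (ε / 2) x)) = univ := by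
    refine eq_univ_of_forall fun z => ?_
    obtain ⟨g, rfl⟩ := hhom x z
    obtain ⟨k, hk, hkg⟩ := hs g.symm
    refine mem_biUnion hk (subset_closure ⟨g.trans k, fun p => ?_, rfl⟩)
    have := hkg (g p)
    rw [dist_comm] at this
    simpa using this
  have : Nonempty X := ⟨x⟩
  have : Countable s := hsc.to_subtype
  rw [biUnion_eq_iUnion] at hcover
  obtain ⟨⟨k, hk⟩, hint⟩ := nonempty_interior_of_iUnion_of_closed
    (fun k : s => isClosed_closure.preimage k.1.continuous) hcover
  change (interior (k ⁻¹' _)).Nonempty at hint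
  rw [← k.preimage_interior] at hint
  obtain ⟨z, hz⟩ := hint
  obtain ⟨_, hw, w, hw1, rfl⟩ := mem_closure_iff.1 (interior_subset hz) _ isOpen_interior hz
  have hn : w ⁻¹' closure (nearOrbit (ε / 2) x) ∈ 𝓝 x :=
    w.continuous.continuousAt (mem_interior_iff_mem_nhds.1 hw)
  refine mem_of_superset hn ?_
  rw [w.preimage_closure]
  refine closure_mono ?_
  rintro p ⟨v, hv, hvp⟩
  refine ⟨v.trans w.symm, fun q => ?_, by simp [hvp]⟩
  have h1 := hw1 (w.symm (v q))
  rw [w.apply_symm_apply, dist_comm] at h1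
  calc dist (w.symm (v q)) q ≤ dist (w.symm (v q)) (v q) + dist (v q) q := dist_triangle _ _ _
    _ < ε / 2 + ε / 2 := add_lt_add h1 (hv q)
    _ = ε := add_halves ε

theorem exists_homeomorph_limit {c : ℝ} (a : ℕ → X ≃ₜ X)
    (h1 : ∀ n x, dist (a n x) (a (n + 1) x) ≤ c / 2 / 2 ^ n)
    (h2 : ∀ n x, dist ((a n).symm x) ((a (n + 1)).symm x) ≤ c / 2 / 2 ^ n) :
    ∃ f : X ≃ₜ X, (∀ x, Tendsto (fun n => a n x) atTop (𝓝 (f x))) ∧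
      (∀ x, dist (a 0 x) (f x) ≤ c) ∧ ∀ x, dist ((a 0).symm x) (f.symm x) ≤ c := by
  have key : ∀ b : ℕ → X ≃ₜ X, (∀ n x, dist (b n x) (b (n + 1) x) ≤ c / 2 / 2 ^ n) →
      ∃ f : X → X, Continuous f ∧ TendstoUniformly (fun n => b n) f atTop ∧
        ∀ x, dist (b 0 x) (f x) ≤ c := by
    intro b hb
    choose f hf using fun x => cauchySeq_tendsto_of_complete
      (cauchySeq_of_le_geometric_two (f := fun n => b n x) (fun n => hb n x))
    have hu : TendstoUniformly (fun n => b n) f atTop := by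
      rw [Metric.tendstoUniformly_iff]
      intro ε hε
      have ht : Tendsto (fun n : ℕ => c / 2 ^ n) atTop (𝓝 0) := by
        simpa [div_eq_mul_inv] using
          (tendsto_pow_atTop_nhds_zero_of_lt_one (r := (2 : ℝ)⁻¹) (by norm_num)
            (by norm_num)).const_mul c
      filter_upwards [ht.eventually_lt_const hε] with n hn x
      rw [dist_comm]
      exact (dist_le_of_le_geometric_two_of_tendsto (fun n => hb n x) (hf x) n).trans_lt hn
    exact ⟨f, hu.continuous (Frequently.of_forall fun n => (b n).continuous), hu,
      fun x => dist_le_of_le_geometric_two_of_tendsto₀ (fun n => hb n x) (hf x)⟩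
  obtain ⟨f, hfc, hfu, hf⟩ := key a h1
  obtain ⟨g, hgc, hgu, hg⟩ := key (fun n => (a n).symm) h2
  have hfg : ∀ x, f (g x) = x := fun x =>
    tendsto_nhds_unique (hfu.tendsto_comp hfc.continuousAt (hgu.tendsto_at x)) (by simp)
  have hgf : ∀ x, g (f x) = x := fun x =>
    tendsto_nhds_unique (hgu.tendsto_comp hgc.continuousAt (hfu.tendsto_at x)) (by simp)
  exact ⟨⟨⟨f, g, hgf, hfg⟩, hfc, hgc⟩, hfu.tendsto_at, hf, hg⟩

/-- Back and forth: small corrections are applied alternately to the images of `x` and of `y`, so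
that two sequences of homeomorphisms converge to `f` and `g` with `f x = g y`. The required map is
`g⁻¹ ∘ f`. -/
theorem exists_homeomorph_near_refl
    (hhom : ∀ p q : X, ∃ h : X ≃ₜ X, h p = q) (x : X) {ε : ℝ} (hε : 0 < ε) :
    ∀ᶠ y in 𝓝 x, ∃ h : X ≃ₜ X, h x = y ∧ ∀ p, dist (h p) p < ε := by
  set c : ℝ := ε / 3 with hc
  have hc0 : 0 < c := by positivity
  -- The tolerance `e a n` also controls `a.symm`, so that the inverses converge uniformly and the
  -- limits are homeomorphisms.
  have hmod : ∀ (a : X ≃ₜ X) (n : ℕ), ∃ e : ℝ, 0 < e ∧ e ≤ c / 2 / 2 ^ n ∧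
      ∀ p q, dist p q < e → dist (a.symm p) (a.symm q) ≤ c / 2 / 2 ^ n := by
    intro a n
    have hpos : 0 < c / 2 / 2 ^ n := by positivity
    obtain ⟨d, hd, h⟩ := Metric.uniformContinuous_iff.1
      (CompactSpace.uniformContinuous_of_continuous a.symm.continuous) _ hpos
    exact ⟨min d (c / 2 / 2 ^ n), lt_min hd hpos, min_le_right _ _,
      fun p q hpq => (h (hpq.trans_le (min_le_left _ _))).le⟩
  choose e he0 hec heu using hmod
  have hal := fun n a z => closure_nearOrbit_mem_nhds hhom (he0 a n) z
  filter_upwards [hal 0 (Homeomorph.refl X) x] with y hy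
  let State (n : ℕ) := {s : (X ≃ₜ X) × (X ≃ₜ X) // s.2 y ∈ closure (nearOrbit (e s.1 n) (s.1 x))}
  have step : ∀ n (s : State n), ∃ s' : State (n + 1),
      (∀ z, dist (s.1.1 z) (s'.1.1 z) < e s.1.1 n) ∧
      (∀ z, dist (s.1.2 z) (s'.1.2 z) < e s.1.2 n) := by
    rintro n ⟨⟨a, b⟩, hs⟩
    obtain ⟨_, hz, w, hw, rfl⟩ := mem_closure_iff_nhds.1 hs _ (hal n b (b y))
    obtain ⟨_, hz', v, hv, rfl⟩ :=
      mem_closure_iff_nhds.1 hz _ (hal (n + 1) (a.trans w) (w (a x)))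
    refine ⟨⟨⟨a.trans w, b.trans v⟩, hz'⟩, fun z => ?_, fun z => ?_⟩
    · rw [dist_comm]; exact hw _
    · rw [dist_comm]; exact hv _
  choose nx hnx1 hnx2 using step
  let st : ∀ n, State n := fun n =>
    Nat.rec ⟨⟨Homeomorph.refl X, Homeomorph.refl X⟩, hy⟩ (fun n s => nx n s) n
  have hsymm : ∀ n (a b : X ≃ₜ X), (∀ z, dist (a z) (b z) < e a n) →
      ∀ z, dist (a.symm z) (b.symm z) ≤ c / 2 / 2 ^ n := by
    intro n a b hab z
    have := heu a n _ _ (hab (b.symm z))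
    rw [dist_comm]
    simpa using this
  have hst1 : ∀ n z, dist ((st n).1.1 z) ((st (n + 1)).1.1 z) < e (st n).1.1 n :=
    fun n z => hnx1 n (st n) z
  have hst2 : ∀ n z, dist ((st n).1.2 z) ((st (n + 1)).1.2 z) < e (st n).1.2 n :=
    fun n z => hnx2 n (st n) z
  obtain ⟨f, hft, hf, -⟩ := exists_homeomorph_limit (fun n => (st n).1.1)
    (fun n z => (hst1 n z).le.trans (hec _ _)) (fun n z => hsymm n _ _ (hst1 n) z)
  obtain ⟨g, hgt, -, hg⟩ := exists_homeomorph_limit (fun n => (st n).1.2)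
    (fun n z => (hst2 n z).le.trans (hec _ _)) (fun n z => hsymm n _ _ (hst2 n) z)
  have heq : f x = g y := by
    refine eq_of_dist_eq_zero (tendsto_nhds_unique ((hft x).dist (hgt y)) ?_)
    have ht : Tendsto (fun n : ℕ => c / 2 / 2 ^ n) atTop (𝓝 0) := by
      simpa [div_eq_mul_inv] using
        (tendsto_pow_atTop_nhds_zero_of_lt_one (r := (2 : ℝ)⁻¹) (by norm_num)
          (by norm_num)).const_mul (c / 2)
    exact squeeze_zero (fun _ => dist_nonneg)
      (fun n => (dist_le_of_mem_closure_nearOrbit (st n).2).trans (hec _ _)) ht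
  refine ⟨f.trans g.symm, by simp [heq], fun p => ?_⟩
  have h1 : dist p (f p) ≤ c := hf p
  have h2 : dist (f p) (g.symm (f p)) ≤ c := hg (f p)
  calc dist (g.symm (f p)) p = dist p (g.symm (f p)) := dist_comm _ _
    _ ≤ dist p (f p) + dist (f p) (g.symm (f p)) := dist_triangle _ _ _
    _ < ε := by linarith

end Effros

/-! ### Heights and slides along suspension lines -/

theorem exists_strictMono_move {u p p' v : ℝ} (hup : u < p) (hpv : p < v) (hup' : u < p')
    (hpv' : p' < v) :
    ∃ T : ℝ → ℝ, StrictMono T ∧ Continuous T ∧ (∀ t ≤ u, T t = t) ∧ (∀ t, v ≤ t → T t = t) ∧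
      T p = p' := by
  have h1 : 0 < p - u := sub_pos.2 hup
  have h2 : 0 < v - p := sub_pos.2 hpv
  -- A tent with peak 1 at `p`. Adding `(p' - p) * B` keeps the identity increasing, because `p' - p
  -- < v - p` and `p - p' < p - u` bound the slopes.
  let B : ℝ → ℝ := fun t => max 0 (min ((t - u) / (p - u)) ((v - t) / (v - p)))
  have hinc : ∀ s t, s < t → B t ≤ B s + (t - s) / (p - u) := by
    intro s t hst
    have h3 : 0 < (t - s) / (p - u) := div_pos (sub_pos.2 hst) h1
    refine max_le (add_nonneg (le_max_left _ _) h3.le) ?_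
    have h4 : (v - t) / (v - p) ≤ (v - s) / (v - p) :=
      div_le_div_of_nonneg_right (by linarith) h2.le
    have h5 : (t - u) / (p - u) = (s - u) / (p - u) + (t - s) / (p - u) := by
      rw [← add_div]; congr 1; ring
    refine le_trans ?_ (add_le_add_left (le_max_right _ _) _)
    rw [← min_add_add_right]
    exact min_le_min h5.le (by linarith)
  have hdec : ∀ s t, s < t → B s ≤ B t + (t - s) / (v - p) := by
    intro s t hst
    have h3 : 0 < (t - s) / (v - p) := div_pos (sub_pos.2 hst) h2
    refine max_le (add_nonneg (le_max_left _ _) h3.le) ?_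
    have h4 : (s - u) / (p - u) ≤ (t - u) / (p - u) :=
      div_le_div_of_nonneg_right (by linarith) h1.le
    have h5 : (v - s) / (v - p) = (v - t) / (v - p) + (t - s) / (v - p) := by
      rw [← add_div]; congr 1; ring
    refine le_trans ?_ (add_le_add_left (le_max_right _ _) _)
    rw [← min_add_add_right]
    exact min_le_min (by linarith) h5.le
  refine ⟨fun t => t + (p' - p) * B t, fun s t hst => ?_, ?_, fun t ht => ?_, fun t ht => ?_, ?_⟩
  · rcases le_total p p' with h | h
    · have h3 : (p' - p) * ((t - s) / (v - p)) < t - s := by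
        rw [mul_div_assoc', div_lt_iff₀ h2, mul_comm]
        exact mul_lt_mul_of_pos_left (by linarith) (sub_pos.2 hst)
      have := mul_le_mul_of_nonneg_left (hdec s t hst) (sub_nonneg.2 h)
      show s + (p' - p) * B s < t + (p' - p) * B t
      linarith
    · have h3 : (p - p') * ((t - s) / (p - u)) < t - s := by
        rw [mul_div_assoc', div_lt_iff₀ h1, mul_comm]
        exact mul_lt_mul_of_pos_left (by linarith) (sub_pos.2 hst)
      have := mul_le_mul_of_nonneg_left (hinc s t hst) (sub_nonneg.2 h)
      show s + (p' - p) * B s < t + (p' - p) * B t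
      linarith
  · fun_prop
  · have : B t = 0 := max_eq_left
      (min_le_of_left_le (div_nonpos_of_nonpos_of_nonneg (by linarith) h1.le))
    simp [this]
  · have : B t = 0 := max_eq_left
      (min_le_of_right_le (div_nonpos_of_nonpos_of_nonneg (by linarith) h2.le))
    simp [this]
  · have : B p = 1 := by simp [B, div_self h1.ne', div_self h2.ne']
    simp [this]

namespace Suspension

variable {Y : Type*}

/-- The height of a point of the suspension above the bottom pole. -/
def height : Suspension Y → ℝ :=
  Quotient.lift (fun a => (a.height : ℝ)) (by
    rintro a b (rfl | ⟨h1, h2⟩ | ⟨h1, h2⟩)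
    · rfl
    · simp [h1, h2]
    · simp [h1, h2])

theorem height_nonneg (x : Suspension Y) : 0 ≤ height x :=
  Quotient.inductionOn x fun a => a.height.2.1

theorem height_le_one (x : Suspension Y) : height x ≤ 1 :=
  Quotient.inductionOn x fun a => a.height.2.2

@[simp] theorem height_pole_false : height (pole Y false) = 0 := rfl

@[simp] theorem height_pole_true : height (pole Y true) = 1 := rfl

theorem height_eq_zero {x : Suspension Y} : height x = 0 ↔ x = pole Y false := by
  refine ⟨?_, fun h => by simp [h]⟩
  induction x using Quotient.inductionOn with | _ a => ?_
  exact fun h => Quotient.sound (Or.inr (Or.inl ⟨Subtype.ext h, rfl⟩))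

theorem height_eq_one {x : Suspension Y} : height x = 1 ↔ x = pole Y true := by
  refine ⟨?_, fun h => by simp [h]⟩
  induction x using Quotient.inductionOn with | _ a => ?_
  exact fun h => Quotient.sound (Or.inr (Or.inr ⟨Subtype.ext h, rfl⟩))

theorem height_lt_one {x : Suspension Y} (hx : x ≠ pole Y true) : height x < 1 :=
  (height_le_one x).lt_of_ne (mt height_eq_one.1 hx)

variable [TopologicalSpace Y]

theorem continuous_height : Continuous (height : Suspension Y → ℝ) := by
  refine Continuous.quotient_lift ?_ _
  refine continuous_sum_dom.2 ⟨?_, continuous_of_discreteTopology⟩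
  exact continuous_subtype_val.comp continuous_snd

/-- The map of the suspension induced by a self-map of the interval that fixes the ends. -/
def mapHeight (φ : unitInterval → unitInterval) (h0 : φ 0 = 0) (h1 : φ 1 = 1) :
    Suspension Y → Suspension Y :=
  Quotient.map (Sum.map (Prod.map id φ) id) (by
    have key : ∀ a : PreSuspension Y,
        PreSuspension.height (Sum.map (Prod.map id φ) id a) = φ a.height := by
      rintro (⟨y, t⟩ | (_ | _))
      · rfl
      · exact h0.symm
      · exact h1.symm
    rintro a b (rfl | ⟨ha, hb⟩ | ⟨ha, hb⟩)
    · exact Or.inl rfl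
    · exact Or.inr (Or.inl ⟨by rw [key, ha, h0], by rw [key, hb, h0]⟩)
    · exact Or.inr (Or.inr ⟨by rw [key, ha, h1], by rw [key, hb, h1]⟩))

theorem continuous_mapHeight {φ : unitInterval → unitInterval} (hφ : Continuous φ) (h0 : φ 0 = 0)
    (h1 : φ 1 = 1) : Continuous (mapHeight (Y := Y) φ h0 h1) :=
  Continuous.quotient_map' ((continuous_id.prodMap hφ).sumMap continuous_id) _

/-- The self-homeomorphism of the suspension induced by one of the interval that fixes the ends. -/
def homeomorphOfHeight (φ : unitInterval ≃ₜ unitInterval) (h0 : φ 0 = 0) (h1 : φ 1 = 1) :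
    Suspension Y ≃ₜ Suspension Y where
  toFun := mapHeight φ h0 h1
  invFun := mapHeight φ.symm (by rw [φ.symm_apply_eq, h0]) (by rw [φ.symm_apply_eq, h1])
  left_inv x := by
    induction x using Quotient.inductionOn with | _ a => ?_
    refine congrArg (Quotient.mk _) ?_
    rcases a with ⟨y, t⟩ | b <;> simp
  right_inv x := by
    induction x using Quotient.inductionOn with | _ a => ?_
    refine congrArg (Quotient.mk _) ?_
    rcases a with ⟨y, t⟩ | b <;> simp
  continuous_toFun := continuous_mapHeight φ.continuous h0 h1
  continuous_invFun := continuous_mapHeight φ.symm.continuous _ _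

theorem exists_homeomorph_of_strictMono {T : ℝ → ℝ} (hT : StrictMono T) (hc : Continuous T)
    (h0 : T 0 = 0) (h1 : T 1 = 1) :
    ∃ s : Suspension Y ≃ₜ Suspension Y, ∀ x, height (s x) = T (height x) ∧
      (T (height x) = height x → s x = x) := by
  let f : unitInterval → unitInterval := fun t =>
    ⟨T t, h0 ▸ hT.monotone t.2.1, h1 ▸ hT.monotone t.2.2⟩
  have hf : Continuous f := (hc.comp continuous_subtype_val).subtype_mk _
  have hinj : f.Injective := fun a b hab => Subtype.ext (hT.injective (congrArg Subtype.val hab))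
  have hsurj : f.Surjective := by
    rintro ⟨t, ht⟩
    obtain ⟨s, hs, hst⟩ := intermediate_value_Icc (zero_le_one (α := ℝ)) hc.continuousOn
      (show t ∈ Icc (T 0) (T 1) by rw [h0, h1]; exact ht)
    exact ⟨⟨s, hs⟩, Subtype.ext hst⟩
  let φ : unitInterval ≃ₜ unitInterval :=
    Continuous.homeoOfEquivCompactToT2 (f := Equiv.ofBijective f ⟨hinj, hsurj⟩) hf
  refine ⟨homeomorphOfHeight φ (Subtype.ext h0) (Subtype.ext h1), fun x => ?_⟩
  induction x using Quotient.inductionOn with | _ a => ?_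
  rcases a with ⟨y, t⟩ | (_ | _)
  · refine ⟨rfl, fun h => congrArg (Quotient.mk _) ?_⟩
    exact congrArg (fun t => Sum.inl (y, t)) (Subtype.ext h)
  · exact ⟨h0.symm, fun _ => rfl⟩
  · exact ⟨h1.symm, fun _ => rfl⟩

/-- A homeomorphism that slides points along suspension lines, from height `p` to height `p'`,
and is supported in the heights strictly between `u` and `v`. -/
theorem exists_slide (Y : Type*) [TopologicalSpace Y] {u p p' v : ℝ} (hu : 0 ≤ u) (hup : u < p)
    (hpv : p < v) (hup' : u < p') (hpv' : p' < v) (hv : v ≤ 1) :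
    ∃ s : Suspension Y ≃ₜ Suspension Y, (∀ x, height x ≤ u → s x = x) ∧
      (∀ x, v ≤ height x → s x = x) ∧ (∀ x, height (s x) ≤ p' ↔ height x ≤ p) ∧
      (∀ x, ∀ q, v ≤ q → (height (s x) ≤ q ↔ height x ≤ q)) ∧
      ∀ x, height x = p → height (s x) = p' := by
  obtain ⟨T, hT, hc, hTu, hTv, hTp⟩ := exists_strictMono_move hup hpv hup' hpv'
  obtain ⟨s, hs⟩ := exists_homeomorph_of_strictMono (Y := Y) hT hc (hTu 0 hu) (hTv 1 hv)
  refine ⟨s, fun x hx => (hs x).2 (hTu _ hx), fun x hx => (hs x).2 (hTv _ hx), fun x => ?_,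
    fun x q hq => ?_, fun x hx => by rw [(hs x).1, hx, hTp]⟩
  · rw [(hs x).1, ← hTp, hT.le_iff_le]
  · rw [(hs x).1]
    nth_rw 1 [← hTv q hq]
    rw [hT.le_iff_le]

end Suspension

/-! ### Correcting a homeomorphism so that it fixes the top pole -/

namespace Suspension

variable {Y : Type*} [TopologicalSpace Y] [CompactSpace (Suspension Y)]

theorem exists_height_bound (g : Suspension Y ≃ₜ Suspension Y) {r : ℝ}
    (hr : r < height (g.symm (pole Y true))) :
    ∃ m < 1, ∀ x, height x ≤ r → height (g x) ≤ m := by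
  have hK : IsCompact {x : Suspension Y | height x ≤ r} :=
    (isClosed_le continuous_height continuous_const).isCompact
  rcases {x : Suspension Y | height x ≤ r}.eq_empty_or_nonempty with he | hne
  · exact ⟨0, one_pos, fun x hx => (he.subset hx).elim⟩
  obtain ⟨z, hz, hmax⟩ :=
    hK.exists_isMaxOn hne (continuous_height.comp g.continuous).continuousOn
  refine ⟨height (g z), height_lt_one fun h => ?_, fun x hx => hmax hx⟩
  rw [← h, g.symm_apply_apply] at hr
  exact hr.not_ge hz

/-- The new map is `φ⁻¹ ∘ g₀ ∘ s`. Here `g₀` is `h` stretched to cover heights up to `m'` yet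
unchanged near S; `s` squeezes heights up to `r` into the zone where `g₀ = h = g`; and `φ = g ∘ s ∘
g⁻¹` undoes the squeeze in the target, restoring `g`. -/
theorem exists_agree_and_cover {h g : Suspension Y ≃ₜ Suspension Y}
    (hh : ∀ x, |height (h x) - height x| < 1 / 8) {r m : ℝ} (hr0 : 1 / 16 ≤ r) (hm : m < 1)
    (hrN : r < height (g.symm (pole Y true))) (hgh : ∀ x, height x ≤ 1 / 16 → g x = h x) :
    ∃ (g' : Suspension Y ≃ₜ Suspension Y) (r' : ℝ), r ≤ r' ∧ m ≤ r' ∧ r' < 1 ∧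
      r' < height (g'.symm (pole Y true)) ∧ (∀ x, height x ≤ r → g' x = g x) ∧
      ∀ x, height x ≤ m → height (g'.symm x) ≤ r' := by
  obtain ⟨q, hrq, hqN⟩ := exists_between hrN
  have hq1 : q < 1 := hqN.trans_le (height_le_one _)
  obtain ⟨m₀, hm₀, hgm₀⟩ := exists_height_bound g hqN
  obtain ⟨m', hm', hm'1⟩ := exists_between (max_lt (max_lt hm hm₀) (show (1 / 2 : ℝ) < 1 by norm_num))
  simp only [max_lt_iff] at hm'
  obtain ⟨⟨hmm', hm₀m'⟩, hm'2⟩ := hm'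
  obtain ⟨r', hr', hr'1⟩ := exists_between (max_lt hm hq1)
  simp only [max_lt_iff] at hr'
  obtain ⟨hmr', hqr'⟩ := hr'
  -- Since `h` moves heights by less than 1/8, it sends heights ≤ 1/16 below 3/16, where `α` is the
  -- identity, and the image of heights ≤ 1/2 contains all heights ≤ 1/4.
  obtain ⟨α, hα1, hα2, hα3, -, -⟩ := exists_slide Y (u := 3 / 16) (p := 1 / 4) (p' := m') (v := 1)
    (by norm_num) (by norm_num) (by norm_num) (by linarith) hm'1 le_rfl
  obtain ⟨κ, hκ1, -, hκ3, -, -⟩ := exists_slide Y (u := 1 / 16) (p := r') (p' := 1 / 2) (v := 1)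
    (by norm_num) (by linarith) hr'1 (by norm_num) (by norm_num) le_rfl
  obtain ⟨s, -, hs2, hs3, hs4, -⟩ := exists_slide Y (u := 0) (p := r) (p' := 1 / 16) (v := q)
    le_rfl (by linarith) hrq (by norm_num) (by linarith) hq1.le
  have hs4' : ∀ x, height (s.symm x) ≤ r' ↔ height x ≤ r' := fun x => by
    simpa using (hs4 (s.symm x) r' hqr'.le).symm
  have hs2' : ∀ x, q ≤ height x → s.symm x = x := fun x hx => by
    rw [s.symm_apply_eq, hs2 x hx]
  set N := pole Y true
  have hN : height N = 1 := height_pole_true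
  let φ := (g.symm.trans s).trans g
  have hφ : ∀ x, φ x = g (s (g.symm x)) := fun _ => rfl
  have hφ1 : ∀ x, q ≤ height (g.symm x) → φ x = x := fun x hx => by
    rw [hφ, hs2 _ hx, g.apply_symm_apply]
  -- Points moved by `φ` lie in the `g`-image of heights below `q`, hence at height at most `m₀ <
  -- m'`.
  have hφ2 : ∀ x, height x ≤ m' → height (φ x) ≤ m' := by
    intro x hx
    by_contra! hlt
    have h1 : φ (φ x) = φ x := by
      refine hφ1 _ ?_
      by_contra! hlt'
      have := hgm₀ _ hlt'.le
      rw [g.apply_symm_apply] at this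
      linarith
    rw [φ.injective h1] at hlt
    exact hlt.not_ge hx
  let g₀ := (κ.trans h).trans α
  have hg₀1 : ∀ x, height x ≤ 1 / 16 → g₀ x = h x := by
    intro x hx
    show α (h (κ x)) = h x
    rw [hκ1 x hx]
    have := abs_lt.1 (hh x)
    exact hα1 _ (by linarith)
  have hg₀2 : ∀ x, height x ≤ m' → height (g₀.symm x) ≤ r' := by
    intro x hx
    show height (κ.symm (h.symm (α.symm x))) ≤ r'
    rw [← hκ3, κ.apply_symm_apply]
    have h1 : height (α.symm x) ≤ 1 / 4 := by rwa [← hα3, α.apply_symm_apply]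
    have h2 := abs_lt.1 (hh (h.symm (α.symm x)))
    rw [h.apply_symm_apply] at h2
    linarith
  have hg₀3 : r' < height (g₀.symm N) := by
    show r' < height (κ.symm (h.symm (α.symm N)))
    have h1 : α.symm N = N := by rw [α.symm_apply_eq, hα2 N hN.ge]
    rw [h1, ← not_le, ← hκ3, κ.apply_symm_apply, not_le]
    have h2 := abs_lt.1 (hh (h.symm N))
    rw [h.apply_symm_apply, hN] at h2
    linarith
  refine ⟨(s.trans g₀).trans φ.symm, r', by linarith, hmr'.le, hr'1, ?_, fun x hx => ?_,
    fun x hx => ?_⟩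
  · show r' < height (s.symm (g₀.symm (φ N)))
    rw [hφ1 N hqN.le, ← not_le, hs4', not_le]
    exact hg₀3
  · show φ.symm (g₀ (s x)) = g x
    have h1 : height (s x) ≤ 1 / 16 := (hs3 x).2 hx
    rw [φ.symm_apply_eq, hg₀1 _ h1, ← hgh _ h1, hφ, g.symm_apply_apply]
  · show height (s.symm (g₀.symm (φ x))) ≤ r'
    rw [hs4']
    exact hg₀2 _ (hφ2 x (hx.trans hmm'.le))

theorem exists_homeomorph_of_exhaustion [T2Space (Suspension Y)]
    (g : ℕ → Suspension Y ≃ₜ Suspension Y) (r m : ℕ → ℝ) (hr : Monotone r) (hr0 : 0 ≤ r 0)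
    (hr1 : Tendsto r atTop (𝓝 1)) (hrlt : ∀ n, r n < 1) (hm1 : Tendsto m atTop (𝓝 1))
    (hN : ∀ n, r n < height ((g n).symm (pole Y true)))
    (hagree : ∀ n x, height x ≤ r n → g (n + 1) x = g n x)
    (hcover : ∀ n x, height x ≤ m n → height ((g n).symm x) ≤ r n) :
    ∃ f : Suspension Y ≃ₜ Suspension Y, f (pole Y true) = pole Y true ∧
      f (pole Y false) = g 0 (pole Y false) := by
  classical
  have hex : ∀ x : Suspension Y, x ≠ pole Y true → ∃ n, height x < r n := fun x hx =>
    (hr1.eventually_const_lt (height_lt_one hx)).exists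
  have hagree' : ∀ n k, n ≤ k → ∀ x, height x ≤ r n → g k x = g n x := by
    intro n k hnk x hx
    induction k, hnk using Nat.le_induction with
    | base => rfl
    | succ k hk ih => rw [hagree k x (hx.trans (hr hk)), ih]
  let f : Suspension Y → Suspension Y := fun x =>
    if hx : x ≠ pole Y true then g (hex x hx).choose x else pole Y true
  have hfN : f (pole Y true) = pole Y true := by simp [f]
  have hf : ∀ n x, height x ≤ r n → f x = g n x := by
    intro n x hx
    have hxN : x ≠ pole Y true := by
      rintro rfl
      exact (hrlt n).not_ge (by simpa using hx)
    have h1 : f x = g (hex x hxN).choose x := dif_pos hxN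
    rw [h1]
    rcases le_total n (hex x hxN).choose with h | h
    · exact hagree' _ _ h x hx
    · exact (hagree' _ _ h x (hex x hxN).choose_spec.le).symm
  have hfne : ∀ x, x ≠ pole Y true → f x ≠ pole Y true := by
    intro x hx he
    obtain ⟨n, hn⟩ := hex x hx
    rw [hf n x hn.le, ← (g n).eq_symm_apply] at he
    exact (hN n).not_gt (he ▸ hn)
  have hinj : f.Injective := by
    intro x x' he
    by_cases hx : x = pole Y true
    · by_contra hne
      exact hfne x' (fun h => hne (hx.trans h.symm)) (by rw [← he, hx, hfN])
    by_cases hx' : x' = pole Y true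
    · exact (hfne x hx (by rw [he, hx', hfN])).elim
    obtain ⟨n, hn⟩ := hex x hx
    obtain ⟨k, hk⟩ := hex x' hx'
    rw [hf (max n k) x (hn.le.trans (hr (le_max_left _ _))),
      hf (max n k) x' (hk.le.trans (hr (le_max_right _ _)))] at he
    exact (g _).injective he
  have hpre : ∀ n w, height w ≤ m n → ∃ z, height z ≤ r n ∧ f z = w := fun n w hw =>
    ⟨(g n).symm w, hcover n w hw, by rw [hf n _ (hcover n w hw), (g n).apply_symm_apply]⟩
  have hsurj : f.Surjective := by
    intro w
    by_cases hw : w = pole Y true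
    · exact ⟨_, hfN.trans hw.symm⟩
    obtain ⟨n, hn⟩ := (hm1.eventually_const_lt (height_lt_one hw)).exists
    obtain ⟨z, -, hz⟩ := hpre n w hn.le
    exact ⟨z, hz⟩
  have hcont : Continuous f := by
    refine continuous_iff_continuousAt.2 fun x => ?_
    by_cases hx : x = pole Y true
    · subst hx
      rw [ContinuousAt, hfN]
      -- By compactness, the sets above a level form a neighbourhood basis at the top pole.
      have hbasis : comap height (𝓝 1) ≤ 𝓝 (pole Y true) := by
        intro U hU
        obtain ⟨V, hVU, hV, hNV⟩ := mem_nhds_iff.1 hU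
        rcases Vᶜ.eq_empty_or_nonempty with he | hne
        · exact mem_of_superset univ_mem fun z _ => hVU (compl_empty_iff.1 he ▸ mem_univ z)
        obtain ⟨z, hz, hmax⟩ := hV.isClosed_compl.isCompact.exists_isMaxOn hne
          continuous_height.continuousOn
        have hz1 : height z < 1 := height_lt_one fun h => hz (h ▸ hNV)
        refine mem_of_superset (preimage_mem_comap (Ioi_mem_nhds hz1)) fun w hw => hVU ?_
        by_contra hwV
        have hle : height w ≤ height z := hmax hwV
        exact hle.not_gt hw
      refine Tendsto.mono_right ?_ hbasis
      rw [tendsto_comap_iff]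
      refine tendsto_order.2 ⟨fun a ha => ?_, fun a ha =>
        Eventually.of_forall fun z => (height_le_one _).trans_lt ha⟩
      obtain ⟨n, hn⟩ := (hm1.eventually_const_lt ha).exists
      have hev : ∀ᶠ z in 𝓝 (pole Y true), r n < height z :=
        continuous_height.continuousAt.eventually_const_lt (by simpa using hrlt n)
      filter_upwards [hev] with z hz
      by_contra! hle
      obtain ⟨z', hz', he⟩ := hpre n (f z) (hle.trans hn.le)
      rw [hinj he] at hz'
      exact hz.not_ge hz'
    · obtain ⟨n, hn⟩ := hex x hx
      refine (g n).continuous.continuousAt.congr ?_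
      filter_upwards [continuous_height.continuousAt.eventually_lt_const hn] with z hz
      exact (hf n z hz.le).symm
  exact ⟨Continuous.homeoOfEquivCompactToT2 (f := Equiv.ofBijective f ⟨hinj, hsurj⟩) hcont, hfN,
    hf 0 _ (by simpa using hr0)⟩

theorem exists_homeomorph_fixing_top_of_near [T2Space (Suspension Y)]
    {h : Suspension Y ≃ₜ Suspension Y} (hh : ∀ x, |height (h x) - height x| < 1 / 8) :
    ∃ f : Suspension Y ≃ₜ Suspension Y, f (pole Y true) = pole Y true ∧
      f (pole Y false) = h (pole Y false) := by
  let m : ℕ → ℝ := fun n => 1 - 1 / ((n : ℝ) + 1)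
  have hm : ∀ n, m n < 1 := fun n => sub_lt_self _ (by positivity)
  have hm1 : Tendsto m atTop (𝓝 1) := by
    simpa [m] using (tendsto_one_div_add_atTop_nhds_zero_nat (𝕜 := ℝ)).const_sub 1
  let State := {s : (Suspension Y ≃ₜ Suspension Y) × ℝ // 1 / 16 ≤ s.2 ∧
    s.2 < height (s.1.symm (pole Y true)) ∧ ∀ x, height x ≤ 1 / 16 → s.1 x = h x}
  have step : ∀ (n : ℕ) (s : State), ∃ s' : State, s.1.2 ≤ s'.1.2 ∧ m n ≤ s'.1.2 ∧ s'.1.2 < 1 ∧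
      (∀ x, height x ≤ s.1.2 → s'.1.1 x = s.1.1 x) ∧
      ∀ x, height x ≤ m n → height (s'.1.1.symm x) ≤ s'.1.2 := by
    rintro n ⟨⟨g, r⟩, hr, hrN, hgh⟩
    obtain ⟨g', r', h1, h2, h3, h4, h5, h6⟩ := exists_agree_and_cover hh hr (hm n) hrN hgh
    exact ⟨⟨⟨g', r'⟩, hr.trans h1, h4, fun x hx => (h5 x (hx.trans hr)).trans (hgh x hx)⟩,
      h1, h2, h3, h5, h6⟩
  choose nx h1 h2 h3 h4 h5 using step
  have hinit : (1 / 16 : ℝ) < height (h.symm (pole Y true)) := by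
    have := abs_lt.1 (hh (h.symm (pole Y true)))
    rw [h.apply_symm_apply, height_pole_true] at this
    linarith
  let st : ℕ → State := fun n =>
    Nat.rec ⟨⟨h, 1 / 16⟩, le_rfl, hinit, fun _ _ => rfl⟩ (fun n s => nx n s) n
  have hlt : ∀ n, (st n).1.2 < 1 := fun n => (st n).2.2.1.trans_le (height_le_one _)
  -- The sequence starts at index 1, because the initial state carries no covering property.
  obtain ⟨f, hfN, hfS⟩ := exists_homeomorph_of_exhaustion (fun n => (st (n + 1)).1.1)
    (fun n => (st (n + 1)).1.2) m (monotone_nat_of_le_succ fun n => h1 (n + 1) (st (n + 1)))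
    (le_trans (by norm_num) (st 1).2.1)
    (tendsto_of_tendsto_of_tendsto_of_le_of_le hm1 tendsto_const_nhds
      (fun n => h2 n (st n)) (fun n => (hlt (n + 1)).le))
    (fun n => hlt (n + 1)) hm1 (fun n => (st (n + 1)).2.2.1)
    (fun n => h4 (n + 1) (st (n + 1))) (fun n => h5 n (st n))
  exact ⟨f, hfN, hfS.trans ((st 1).2.2.2 _ (by simp))⟩

theorem exists_homeomorph_fixing_top [TopologicalSpace.MetrizableSpace (Suspension Y)]
    (hhom : ∀ p q : Suspension Y, ∃ h : Suspension Y ≃ₜ Suspension Y, h p = q)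
    {y : Suspension Y} (hy : y ≠ pole Y true) :
    ∃ f : Suspension Y ≃ₜ Suspension Y, f (pole Y true) = pole Y true ∧ f (pole Y false) = y := by
  let := TopologicalSpace.metrizableSpaceMetric (Suspension Y)
  by_cases hyS : y = pole Y false
  · exact ⟨Homeomorph.refl _, rfl, hyS.symm⟩
  have hy0 : 0 < height y := (height_nonneg y).lt_of_ne' (mt height_eq_zero.1 hyS)
  obtain ⟨δ, hδ, hu⟩ := Metric.uniformContinuous_iff.1
    (CompactSpace.uniformContinuous_of_continuous (continuous_height (Y := Y))) (1 / 8)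
    (by norm_num)
  have hnear := exists_homeomorph_near_refl hhom (pole Y false) hδ
  obtain ⟨V, hVU, hV, hSV⟩ := mem_nhds_iff.1 hnear
  -- A slide prescribes only the height of the image of `y`, so a whole level set has to lie in `V`.
  obtain ⟨c, hc0, hc1, hcV⟩ : ∃ c : ℝ, 0 < c ∧ c < 1 ∧ ∀ z : Suspension Y, height z = c → z ∈ V := by
    rcases Vᶜ.eq_empty_or_nonempty with he | hne
    · exact ⟨1 / 2, by norm_num, by norm_num, fun z _ => compl_empty_iff.1 he ▸ mem_univ z⟩
    obtain ⟨z, hz, hmin⟩ := hV.isClosed_compl.isCompact.exists_isMinOn hne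
      continuous_height.continuousOn
    have hz0 : 0 < height z :=
      (height_nonneg z).lt_of_ne' fun h => hz (height_eq_zero.1 h ▸ hSV)
    refine ⟨height z / 2, by linarith, by linarith [height_le_one z], fun w hw => ?_⟩
    by_contra hwV
    have : height z ≤ height w := hmin hwV
    linarith
  obtain ⟨s, -, hs2, -, -, hs5⟩ := exists_slide Y le_rfl hy0 (height_lt_one hy) hc0 hc1 le_rfl
  obtain ⟨h, hhS, hhd⟩ := hVU (hcV _ (hs5 y rfl))
  obtain ⟨f, hfN, hfS⟩ := exists_homeomorph_fixing_top_of_near fun x => by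
    simpa [Real.dist_eq] using hu (hhd x)
  refine ⟨f.trans s.symm, ?_, ?_⟩
  · rw [Homeomorph.trans_apply, hfN, s.symm_apply_eq, hs2 _ (by simp)]
  · rw [Homeomorph.trans_apply, hfS, hhS, s.symm_apply_apply]

theorem exists_homeomorph_poles [TopologicalSpace.MetrizableSpace (Suspension Y)]
    (hhom : ∀ p q : Suspension Y, ∃ h : Suspension Y ≃ₜ Suspension Y, h p = q)
    {p q : Suspension Y} (hpq : p ≠ q) :
    ∃ f : Suspension Y ≃ₜ Suspension Y, f (pole Y false) = p ∧ f (pole Y true) = q := by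
  obtain ⟨k, rfl⟩ := hhom (pole Y true) q
  obtain ⟨f, hfN, hfS⟩ := exists_homeomorph_fixing_top hhom (y := k.symm p)
    fun h => hpq (by rw [← h, k.apply_symm_apply])
  exact ⟨f.trans k, by simp [hfS], by simp [hfN]⟩

end Suspension

/-! ### Absolute suspension and strong 2-homogeneity -/

theorem corollary1 (X : Type u) [TopologicalSpace X] [CompactSpace X]
    [TopologicalSpace.MetrizableSpace X] (hsusp : IsSuspension X) (hhom : IsHomogeneousSpace X) :
    IsAbsoluteSuspension X ∧ IsStronglyHomogeneous 2 X := by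
  classical
  obtain ⟨Y, _, ⟨e⟩⟩ := hsusp
  have : CompactSpace (Suspension Y) := e.compactSpace
  have : TopologicalSpace.MetrizableSpace (Suspension Y) := e.symm.isEmbedding.metrizableSpace
  have hhom' : ∀ p q : Suspension Y, ∃ h : Suspension Y ≃ₜ Suspension Y, h p = q := fun p q => by
    obtain ⟨h, hh⟩ := hhom (e.symm p) (e.symm q)
    exact ⟨(e.symm.trans h).trans e, by simp [hh]⟩
  have key : ∀ p q : X, p ≠ q → ∃ f : X ≃ₜ Suspension Y,
      f p = Suspension.pole Y false ∧ f q = Suspension.pole Y true := fun p q hpq => by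
    obtain ⟨f, hf1, hf2⟩ := Suspension.exists_homeomorph_poles hhom' (e.injective.ne hpq)
    exact ⟨e.trans f.symm, by simp [← hf1], by simp [← hf2]⟩
  refine ⟨fun p q hpq => ⟨Y, _, key p q hpq⟩, fun A B hA _ f => ?_⟩
  obtain ⟨p, q, hpq, rfl⟩ := Finset.card_eq_two.1 hA
  let a : ({p, q} : Finset X) := ⟨p, by simp⟩
  let b : ({p, q} : Finset X) := ⟨q, by simp⟩
  have hfab : (f a : X) ≠ f b := fun h =>
    hpq (congrArg Subtype.val (f.injective (Subtype.ext h)))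
  -- Both pairs are carried to the poles of the same suspension, so the two charts compose.
  obtain ⟨k₁, h₁, h₂⟩ := key p q hpq
  obtain ⟨k₂, h₃, h₄⟩ := key _ _ hfab
  refine ⟨k₁.trans k₂.symm, ?_⟩
  rintro ⟨x, hx⟩
  rcases Finset.mem_insert.1 hx with rfl | hx'
  · rw [Homeomorph.trans_apply, h₁, k₂.symm_apply_eq, h₃]
  · obtain rfl := Finset.mem_singleton.1 hx'
    rw [Homeomorph.trans_apply, h₂, k₂.symm_apply_eq, h₄]
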